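/- Let $\sigma>0$ and let $f:\mathbb{C}\to\mathbb{C}$ be an entire function of exponential type at most $\sigma$, that is, for every $\varepsilon>0$ there is a constant $C_\varepsilon>0$ such that $|f(z)|\le C_\varepsilon e^{(\sigma+\varepsilon)|z|}$ for all $z\in\mathbb{C}$. Suppose that the restriction of $f$ to the real line belongs to $L^2(\mathbb{R})$. Then $\int_{-\infty}^{\infty}|f^{(k)}(x)|^2\,dx<\infty$ for every integer $k\ge 0$, and for every nonnegative integer $N$ $$\sum_{k=0}^{N}\frac{(-1)^k}{\sigma^{2k}}\binom{N}{k}\int_{-\infty}^{\infty}\big|f^{(k)}(x)\big|^2\,dx\ \ge\ 0 .$$ In particular, for $N=2$, $$\int_{-\infty}^{\infty}|f'(x)|^2\,dx\ \le\ \frac12\left(\sigma^2\int_{-\infty}^{\infty}|f(x)|^2\,dx+\frac1{\sigma^2}\int_{-\infty}^{\infty}|f''(x)|^2\,dx\right).$$ -/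

import Mathlib

/-- `f : ℂ → ℂ` is an entire function of exponential type at most `σ`: it is holomorphic on all
of `ℂ`, and for every `ε > 0` there is a positive constant `C` with
`|f z| ≤ C e ^ ((σ + ε) |z|)` for all complex `z`. -/
def IsEntireOfExpTypeAtMost (σ : ℝ) (f : ℂ → ℂ) : Prop :=
  Differentiable ℂ f ∧
    ∀ ε : ℝ, 0 < ε → ∃ C : ℝ, 0 < C ∧ ∀ z : ℂ, ‖f z‖ ≤ C * Real.exp ((σ + ε) * ‖z‖)

/-! Write `a k` for the square norm of the `k`-th derivative on the line. On the Fourier side the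
sum is the integral of `(1 - ξ²/σ²)^N |f̂(ξ)|²`, with `f̂` supported in `[-σ, σ]`. The proof
imitates this without Fourier analysis. For `N = 1` the claim is Bernstein's inequality `a 1 ≤ σ² a
0`. Phragmén–Lindelöf and Cauchy estimates for a correlation integral give `a k ≤ (k! e^(σr) / r^k)²
a 0` (`integral_norm_sq_iteratedDeriv_le`), which is too weak for a single `k`. But `a` is
log-convex, so `(a 1 / a 0)^k a 0 ≤ a k`, and using all `k` and `r` forces `a 1 / a 0 ≤ σ²`. For
larger `N`, passing from `f` to `σ² f + f''` multiplies the Fourier weight by `σ⁴(1 - ξ²/σ²)²`, so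
induction in steps of two reduces to `N = 0` and `N = 1`. -/

open Filter Topology MeasureTheory

/-! ### Closure properties of the class of type at most `σ`. -/

namespace IsEntireOfExpTypeAtMost

variable {σ : ℝ} {f g : ℂ → ℂ}

theorem add (hf : IsEntireOfExpTypeAtMost σ f) (hg : IsEntireOfExpTypeAtMost σ g) :
    IsEntireOfExpTypeAtMost σ (fun z => f z + g z) := by
  refine ⟨hf.1.add hg.1, fun ε hε => ?_⟩
  obtain ⟨C, hC, h⟩ := hf.2 ε hε
  obtain ⟨D, hD, h'⟩ := hg.2 ε hε
  refine ⟨C + D, by positivity, fun z => (norm_add_le _ _).trans ?_⟩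
  rw [add_mul]
  exact add_le_add (h z) (h' z)

theorem const_mul (hf : IsEntireOfExpTypeAtMost σ f) (c : ℂ) :
    IsEntireOfExpTypeAtMost σ (fun z => c * f z) := by
  refine ⟨hf.1.const_mul c, fun ε hε => ?_⟩
  obtain ⟨C, hC, h⟩ := hf.2 ε hε
  refine ⟨(‖c‖ + 1) * C, by positivity, fun z => ?_⟩
  rw [norm_mul, mul_assoc]
  exact mul_le_mul (by linarith) (h z) (norm_nonneg _) (by positivity)

theorem comp_neg (hf : IsEntireOfExpTypeAtMost σ f) :
    IsEntireOfExpTypeAtMost σ (fun z => f (-z)) := by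
  refine ⟨hf.1.comp differentiable_neg, fun ε hε => ?_⟩
  obtain ⟨C, hC, h⟩ := hf.2 ε hε
  exact ⟨C, hC, fun z => by simpa using h (-z)⟩

theorem deriv (hσ : 0 ≤ σ) (hf : IsEntireOfExpTypeAtMost σ f) :
    IsEntireOfExpTypeAtMost σ (_root_.deriv f) := by
  refine ⟨hf.1.deriv, fun ε hε => ?_⟩
  obtain ⟨C, hC, h⟩ := hf.2 ε hε
  refine ⟨C * Real.exp (σ + ε), by positivity, fun z => ?_⟩
  have := Complex.norm_deriv_le_of_forall_mem_sphere_norm_le (c := z) (R := 1)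
    (C := C * Real.exp (σ + ε) * Real.exp ((σ + ε) * ‖z‖)) one_pos hf.1.diffContOnCl ?_
  · simpa using this
  · intro w hw
    refine (h w).trans ?_
    rw [mul_assoc, ← Real.exp_add]
    have hw' : ‖w‖ ≤ ‖z‖ + 1 := by
      have h1 : ‖w - z‖ = 1 := by simpa using hw
      have := norm_add_le z (w - z)
      rw [add_sub_cancel, h1] at this
      exact this
    gcongr
    nlinarith [mul_le_mul_of_nonneg_left hw' (by positivity : 0 ≤ σ + ε)]

theorem iteratedDeriv (hσ : 0 ≤ σ) (hf : IsEntireOfExpTypeAtMost σ f) (k : ℕ) :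
    IsEntireOfExpTypeAtMost σ (_root_.iteratedDeriv k f) := by
  induction k with
  | zero => simpa using hf
  | succ k ih => rw [iteratedDeriv_succ]; exact ih.deriv hσ

/-! ### Growth of functions bounded on the real line (Phragmén–Lindelöf). -/

/-- A function of exponential type that is bounded on the real line by `M` is bounded in the upper
half-plane by `M e ^ ((σ + ε) Im z)`. -/
theorem norm_mul_I_le (hσ : 0 ≤ σ) (hf : IsEntireOfExpTypeAtMost σ f) {M : ℝ}
    (hM : ∀ x : ℝ, ‖f x‖ ≤ M) {ε : ℝ} (hε : 0 < ε) {w : ℂ} (hw : 0 ≤ w.re) :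
    ‖f (w * Complex.I)‖ ≤ M * Real.exp ((σ + ε) * w.re) := by
  -- The type bound is used with `ε / 2`, so that after multiplication by `e^(-(σ+ε)w)` a decay
  -- `e^(-εx/2)` remains on the positive real axis.
  obtain ⟨C, hC, h⟩ := hf.2 (ε / 2) (by positivity)
  have hnorm : ∀ w : ℂ, ‖f (w * Complex.I) * Complex.exp (-((σ + ε : ℝ) * w))‖
      = ‖f (w * Complex.I)‖ * Real.exp (-((σ + ε) * w.re)) := by
    intro w
    rw [norm_mul, Complex.norm_exp, Complex.neg_re, Complex.re_ofReal_mul]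
  have key := PhragmenLindelof.right_half_plane_of_tendsto_zero_on_real
    (f := fun w => f (w * Complex.I) * Complex.exp (-((σ + ε : ℝ) * w))) (C := M) (z := w)
    ?_ ?_ ?_ ?_ hw
  · simp only [hnorm] at key
    rw [Real.exp_neg, ← div_eq_mul_inv, div_le_iff₀ (Real.exp_pos _)] at key
    exact key
  · refine Differentiable.diffContOnCl ?_
    exact (hf.1.comp (differentiable_id.mul_const _)).mul
      ((differentiable_id.const_mul _).neg.cexp)
  · refine ⟨1, by norm_num, 2 * (σ + ε), Asymptotics.IsBigO.of_bound C
      (Eventually.of_forall fun w => ?_)⟩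
    rw [hnorm, Real.norm_of_nonneg (Real.exp_pos _).le, Real.rpow_one]
    have h1 := h (w * Complex.I)
    rw [norm_mul, Complex.norm_I, mul_one] at h1
    refine (mul_le_mul_of_nonneg_right h1 (Real.exp_pos _).le).trans ?_
    rw [mul_assoc, ← Real.exp_add]
    gcongr
    have h2 := (abs_le.1 (Complex.abs_re_le_norm w)).1
    nlinarith [norm_nonneg w, mul_le_mul_of_nonneg_left h2 (by positivity : 0 ≤ σ + ε),
      mul_nonneg hε.le (norm_nonneg w)]
  · have hlim : Tendsto (fun x : ℝ => C * Real.exp (-(ε / 2 * x))) atTop (𝓝 0) := by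
      rw [← mul_zero C]
      refine Tendsto.const_mul _ (Real.tendsto_exp_neg_atTop_nhds_zero.comp ?_)
      exact tendsto_id.const_mul_atTop (by positivity)
    refine squeeze_zero_norm' ?_ hlim
    filter_upwards [eventually_ge_atTop 0] with x hx
    rw [hnorm]
    have h1 := h (x * Complex.I)
    rw [norm_mul, Complex.norm_I, mul_one, Complex.norm_of_nonneg hx] at h1
    refine (mul_le_mul_of_nonneg_right h1 (Real.exp_pos _).le).trans (le_of_eq ?_)
    rw [mul_assoc, ← Real.exp_add, Complex.ofReal_re]
    ring_nf
  · intro x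
    rw [hnorm]
    have := hM (-x)
    simpa [mul_assoc] using this

/-- A function of exponential type at most `σ` that is bounded on the real line by `M` satisfies
`|f z| ≤ M e ^ (σ |z|)` in the whole plane. -/
theorem norm_le (hσ : 0 ≤ σ) (hf : IsEntireOfExpTypeAtMost σ f) {M : ℝ}
    (hM : ∀ x : ℝ, ‖f x‖ ≤ M) (z : ℂ) : ‖f z‖ ≤ M * Real.exp (σ * ‖z‖) := by
  have hM0 : 0 ≤ M := (norm_nonneg _).trans (hM 0)
  have hbound : ∀ ε : ℝ, 0 < ε → ‖f z‖ ≤ M * Real.exp ((σ + ε) * ‖z‖) := by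
    intro ε hε
    have him := abs_le.1 (Complex.abs_im_le_norm z)
    rcases le_total 0 z.im with h | h
    · have := hf.norm_mul_I_le hσ hM hε (w := -Complex.I * z) (by simpa using h)
      rw [show -Complex.I * z * Complex.I = z by linear_combination -z * Complex.I_mul_I] at this
      refine this.trans ?_
      gcongr
      simpa using him.2
    · have := hf.comp_neg.norm_mul_I_le hσ (M := M)
        (fun x => by simpa using hM (-x)) hε (w := Complex.I * z) (by simpa using h)
      rw [show -(Complex.I * z * Complex.I) = z by linear_combination -z * Complex.I_mul_I] at this
      refine this.trans ?_
      gcongr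
      simpa using neg_le.1 him.1
  -- Unlike the constants in the definition of type, `M` does not depend on `ε`, so `ε` can tend to
  -- `0`.
  have hcont : Continuous fun ε : ℝ => M * Real.exp ((σ + ε) * ‖z‖) := by fun_prop
  have hlim : Tendsto (fun ε : ℝ => M * Real.exp ((σ + ε) * ‖z‖)) (𝓝[>] 0)
      (𝓝 (M * Real.exp (σ * ‖z‖))) := by
    have := hcont.tendsto 0
    rw [add_zero] at this
    exact this.mono_left nhdsWithin_le_nhds
  exact ge_of_tendsto hlim (eventually_mem_nhdsWithin.mono hbound)

end IsEntireOfExpTypeAtMost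

/-! ### Correlation integrals over compact intervals. -/

/-- Differentiation under the integral sign for the correlation of an entire function with a
continuous function on a compact interval. -/
theorem hasDerivAt_integral_comp_add_mul {f : ℂ → ℂ} (hf : Differentiable ℂ f) {φ : ℝ → ℂ}
    (hφ : Continuous φ) (a b : ℝ) (z : ℂ) :
    HasDerivAt (fun z => ∫ t in a..b, f (z + t) * φ t)
      (∫ t in a..b, deriv f (z + t) * φ t) z := by
  have hf' : Continuous (deriv f) := hf.deriv.continuous
  have hfc : Continuous f := hf.continuous
  have hcpt := (isCompact_closedBall z 1).prod (isCompact_uIcc (a := a) (b := b))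
  obtain ⟨C, hC⟩ := hcpt.exists_bound_of_continuousOn
    (f := fun p : ℂ × ℝ => deriv f (p.1 + p.2) * φ p.2)
    (by fun_prop)
  refine (intervalIntegral.hasDerivAt_integral_of_dominated_loc_of_deriv_le
    (F := fun z t => f (z + t) * φ t) (F' := fun z t => deriv f (z + t) * φ t)
    (bound := fun _ => C) (Metric.ball_mem_nhds z one_pos) (Eventually.of_forall fun w => ?_)
    ?_ ?_ ?_ intervalIntegrable_const ?_).2
  · exact Continuous.aestronglyMeasurable (by fun_prop)
  · exact Continuous.intervalIntegrable (by fun_prop) _ _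
  · exact Continuous.aestronglyMeasurable (by fun_prop)
  · refine Eventually.of_forall fun t ht w hw => ?_
    exact hC (w, t) ⟨Metric.ball_subset_closedBall hw, Set.uIoc_subset_uIcc ht⟩
  · refine Eventually.of_forall fun t _ w _ => ?_
    exact ((hf _).hasDerivAt.comp_add_const w (t : ℂ)).mul_const (φ t)

theorem iteratedDeriv_integral_comp_add_mul {f : ℂ → ℂ} (hf : Differentiable ℂ f) {φ : ℝ → ℂ}
    (hφ : Continuous φ) (a b : ℝ) (k : ℕ) :
    iteratedDeriv k (fun z => ∫ t in a..b, f (z + t) * φ t) =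
      fun z => ∫ t in a..b, iteratedDeriv k f (z + t) * φ t := by
  induction k generalizing f with
  | zero => simp
  | succ k ih =>
    rw [iteratedDeriv_succ', iteratedDeriv_succ', ← ih hf.deriv]
    congr 1
    exact funext fun z => (hasDerivAt_integral_comp_add_mul hf hφ a b z).deriv

theorem IsEntireOfExpTypeAtMost.integral_comp_add_mul {σ : ℝ} (hσ : 0 ≤ σ) {f : ℂ → ℂ}
    (hf : IsEntireOfExpTypeAtMost σ f) {φ : ℝ → ℂ} (hφ : Continuous φ) (a b : ℝ) :
    IsEntireOfExpTypeAtMost σ (fun z => ∫ t in a..b, f (z + t) * φ t) := by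
  refine ⟨fun z => (hasDerivAt_integral_comp_add_mul hf.1 hφ a b z).differentiableAt,
    fun ε hε => ?_⟩
  obtain ⟨C, hC, h⟩ := hf.2 ε hε
  obtain ⟨D, hD⟩ := (isCompact_uIcc (a := a) (b := b)).exists_bound_of_continuousOn
    (f := fun t : ℝ => (Real.exp ((σ + ε) * |t|) : ℂ) * φ t) (by fun_prop)
  have hD0 : 0 ≤ D := (norm_nonneg _).trans (hD a Set.left_mem_uIcc)
  -- The `+ 1` only makes the constant positive when `D = 0` or `a = b`.
  refine ⟨C * D * |b - a| + 1, by positivity, fun z => ?_⟩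
  have := intervalIntegral.norm_integral_le_of_norm_le_const (a := a) (b := b)
    (f := fun t : ℝ => f (z + t) * φ t) (C := C * D * Real.exp ((σ + ε) * ‖z‖)) ?_
  · refine this.trans ?_
    nlinarith [Real.exp_pos ((σ + ε) * ‖z‖)]
  · intro t ht
    have h1 := hD t (Set.uIoc_subset_uIcc ht)
    rw [norm_mul, Complex.norm_of_nonneg (Real.exp_pos _).le] at h1
    have h2 : ‖f (z + t)‖ ≤ C * (Real.exp ((σ + ε) * ‖z‖) * Real.exp ((σ + ε) * |t|)) := by
      refine (h _).trans ?_
      rw [← Real.exp_add, ← mul_add]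
      have : ‖z + (t : ℂ)‖ ≤ ‖z‖ + |t| := by simpa using norm_add_le z (t : ℂ)
      gcongr
    rw [norm_mul]
    calc ‖f (z + t)‖ * ‖φ t‖
        ≤ C * (Real.exp ((σ + ε) * ‖z‖) * Real.exp ((σ + ε) * |t|)) * ‖φ t‖ := by gcongr
      _ = C * Real.exp ((σ + ε) * ‖z‖) * (Real.exp ((σ + ε) * |t|) * ‖φ t‖) := by ring
      _ ≤ C * Real.exp ((σ + ε) * ‖z‖) * D := by gcongr
      _ = _ := by ring

/-! ### Square integrability of the derivatives. -/

theorem integrable_norm_sq_iff_memLp {f : ℂ → ℂ} (hf : Continuous f) :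
    Integrable (fun x : ℝ => ‖f x‖ ^ 2) ↔ MemLp (fun x : ℝ => f x) 2 :=
  (memLp_two_iff_integrable_sq_norm
    (Continuous.aestronglyMeasurable (by fun_prop))).symm

namespace IsEntireOfExpTypeAtMost

variable {σ : ℝ} {f : ℂ → ℂ}

/-- Duality argument: correlate `f` with the conjugate of its own `k`-th derivative cut off to `[-R,
R]`. The correlation `G` has type at most `σ`, is bounded on the line, and its `k`-th derivative at
`0` is the left side `B`; a Cauchy estimate on `|z| = r` then bounds `B`. The cutoff makes `B`
finite beforehand, so it can be absorbed. -/
theorem intervalIntegral_norm_sq_iteratedDeriv_le (hσ : 0 ≤ σ)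
    (hf : IsEntireOfExpTypeAtMost σ f) (hf2 : Integrable (fun x : ℝ => ‖f x‖ ^ 2)) (k : ℕ)
    {r : ℝ} (hr : 0 < r) {R : ℝ} (hR : 0 ≤ R) :
    ∫ t in (-R)..R, ‖_root_.iteratedDeriv k f t‖ ^ 2 ≤
      (k.factorial * Real.exp (σ * r) / r ^ k) ^ 2 * ∫ x : ℝ, ‖f x‖ ^ 2 := by
  set K : ℝ := k.factorial * Real.exp (σ * r) / r ^ k with hK
  have hK0 : 0 < K := by positivity
  set A : ℝ := ∫ x : ℝ, ‖f x‖ ^ 2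
  set B : ℝ := ∫ t in (-R)..R, ‖_root_.iteratedDeriv k f t‖ ^ 2 with hB
  have hfc : Continuous f := hf.1.continuous
  have hkc : Continuous (_root_.iteratedDeriv k f) := (hf.iteratedDeriv hσ k).1.continuous
  let φ : ℝ → ℂ := fun t => (starRingEnd ℂ) (_root_.iteratedDeriv k f t)
  have hφ : Continuous φ := Complex.continuous_conj.comp (by fun_prop)
  let G : ℂ → ℂ := fun z => ∫ t in (-R)..R, f (z + t) * φ t
  have hG : IsEntireOfExpTypeAtMost σ G := hf.integral_comp_add_mul hσ hφ _ _
  have hGB : _root_.iteratedDeriv k G 0 = (B : ℂ) := by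
    rw [iteratedDeriv_integral_comp_add_mul hf.1 hφ, hB, ← intervalIntegral.integral_ofReal]
    refine intervalIntegral.integral_congr fun t _ => ?_
    simp only [zero_add, φ, Complex.mul_conj, Complex.normSq_eq_norm_sq]
  -- Weighted AM-GM replaces Cauchy–Schwarz. With weight `K` the Cauchy estimate reads `B ≤ (K² A +
  -- B) / 2`, that is, `B ≤ K² A`.
  have hM : ∀ x : ℝ, ‖G x‖ ≤ (K * A + K⁻¹ * B) / 2 := by
    intro x
    have hle : -R ≤ R := by linarith
    have h1 : ‖G x‖ ≤ ∫ t in (-R)..R,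
        (K / 2 * ‖f ((x + t : ℝ) : ℂ)‖ ^ 2 + K⁻¹ / 2 * ‖_root_.iteratedDeriv k f t‖ ^ 2) := by
      refine intervalIntegral.norm_integral_le_of_norm_le hle
        (Eventually.of_forall fun t _ => ?_) (Continuous.intervalIntegrable (by fun_prop) _ _)
      rw [norm_mul, RCLike.norm_conj, Complex.ofReal_add]
      have hkk : K * K⁻¹ = 1 := mul_inv_cancel₀ hK0.ne'
      have hsq := mul_nonneg (inv_pos.2 hK0).le
        (sq_nonneg (K * ‖f (x + t)‖ - ‖_root_.iteratedDeriv k f t‖))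
      have hexp : K⁻¹ * (K * ‖f (x + t)‖ - ‖_root_.iteratedDeriv k f t‖) ^ 2 =
          K * ‖f (x + t)‖ ^ 2 - 2 * (‖f (x + t)‖ * ‖_root_.iteratedDeriv k f t‖)
            + K⁻¹ * ‖_root_.iteratedDeriv k f t‖ ^ 2 := by
        field_simp
        ring
      linarith
    have h2 : ∫ t in (-R)..R, ‖f ((x + t : ℝ) : ℂ)‖ ^ 2 ≤ A := by
      rw [intervalIntegral.integral_comp_add_left (fun u : ℝ => ‖f (u : ℂ)‖ ^ 2) x,
        intervalIntegral.integral_of_le (by linarith)]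
      exact setIntegral_le_integral hf2 (Eventually.of_forall fun _ => by positivity)
    rw [intervalIntegral.integral_add (Continuous.intervalIntegrable (by fun_prop) _ _)
      (Continuous.intervalIntegrable (by fun_prop) _ _), intervalIntegral.integral_const_mul,
      intervalIntegral.integral_const_mul] at h1
    nlinarith
  have hCauchy := Complex.norm_iteratedDeriv_le_of_forall_mem_sphere_norm_le (c := 0) (f := G)
    (C := (K * A + K⁻¹ * B) / 2 * Real.exp (σ * r)) k hr hG.1.diffContOnCl (fun z hz => by
      have hz' : ‖z‖ = r := by simpa using hz
      simpa [hz'] using hG.norm_le hσ hM z)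
  rw [hGB, Complex.norm_real] at hCauchy
  have h3 : B ≤ K * ((K * A + K⁻¹ * B) / 2) := by
    refine (le_abs_self B).trans (hCauchy.trans (le_of_eq ?_))
    rw [hK]
    ring
  have h4 : K * ((K * A + K⁻¹ * B) / 2) = (K ^ 2 * A + B) / 2 := by
    field_simp
  linarith

theorem integrable_norm_sq_iteratedDeriv (hσ : 0 ≤ σ)
    (hf : IsEntireOfExpTypeAtMost σ f) (hf2 : Integrable (fun x : ℝ => ‖f x‖ ^ 2)) (k : ℕ) :
    Integrable (fun x : ℝ => ‖_root_.iteratedDeriv k f x‖ ^ 2) := by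
  have hkc : Continuous (_root_.iteratedDeriv k f) := (hf.iteratedDeriv hσ k).1.continuous
  refine integrable_of_intervalIntegral_norm_bounded (l := atTop) (a := fun R : ℝ => -R)
    (b := fun R => R) ((k.factorial * Real.exp (σ * 1) / 1 ^ k) ^ 2 * ∫ x : ℝ, ‖f x‖ ^ 2)
    (fun R => ?_) tendsto_neg_atTop_atBot tendsto_id
    ((eventually_ge_atTop 0).mono fun R hR => ?_)
  · exact (Continuous.integrableOn_Icc (by fun_prop)).mono_set Set.Ioc_subset_Icc_self
  · simpa using hf.intervalIntegral_norm_sq_iteratedDeriv_le hσ hf2 k one_pos hR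

theorem integral_norm_sq_iteratedDeriv_le (hσ : 0 ≤ σ)
    (hf : IsEntireOfExpTypeAtMost σ f) (hf2 : Integrable (fun x : ℝ => ‖f x‖ ^ 2)) (k : ℕ)
    {r : ℝ} (hr : 0 < r) :
    ∫ x : ℝ, ‖_root_.iteratedDeriv k f x‖ ^ 2 ≤
      (k.factorial * Real.exp (σ * r) / r ^ k) ^ 2 * ∫ x : ℝ, ‖f x‖ ^ 2 :=
  le_of_tendsto (intervalIntegral_tendsto_integral
    (hf.integrable_norm_sq_iteratedDeriv hσ hf2 k) tendsto_neg_atTop_atBot tendsto_id)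
    ((eventually_ge_atTop 0).mono fun _ hR =>
      hf.intervalIntegral_norm_sq_iteratedDeriv_le hσ hf2 k hr hR)

theorem integrable_norm_sq_deriv (hσ : 0 ≤ σ) (hf : IsEntireOfExpTypeAtMost σ f)
    (hf2 : Integrable (fun x : ℝ => ‖f x‖ ^ 2)) :
    Integrable (fun x : ℝ => ‖_root_.deriv f x‖ ^ 2) := by
  simpa using hf.integrable_norm_sq_iteratedDeriv hσ hf2 1

/-! ### Integration by parts and log-convexity. -/

/-- Integration by parts: the square norm of `s f + f''`. -/
theorem integral_norm_sq_add_deriv_deriv (hσ : 0 ≤ σ) (hf : IsEntireOfExpTypeAtMost σ f)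
    (hf2 : Integrable (fun x : ℝ => ‖f x‖ ^ 2)) (s : ℝ) :
    ∫ x : ℝ, ‖s * f x + _root_.deriv (_root_.deriv f) x‖ ^ 2 =
      s ^ 2 * (∫ x : ℝ, ‖f x‖ ^ 2) - 2 * s * (∫ x : ℝ, ‖_root_.deriv f x‖ ^ 2) +
        ∫ x : ℝ, ‖_root_.deriv (_root_.deriv f) x‖ ^ 2 := by
  have hd := hf.deriv hσ
  have hdd := hd.deriv hσ
  have hd2 := hf.integrable_norm_sq_deriv hσ hf2
  have hdd2 := hd.integrable_norm_sq_deriv hσ hd2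
  have m0 := (integrable_norm_sq_iff_memLp hf.1.continuous).1 hf2
  have m1 := (integrable_norm_sq_iff_memLp hd.1.continuous).1 hd2
  have m2 := (integrable_norm_sq_iff_memLp hdd.1.continuous).1 hdd2
  have hi : Integrable (fun x : ℝ => f x * star (_root_.deriv (_root_.deriv f) x)) :=
    m0.integrable_mul m2.star
  have hparts : ∫ x : ℝ, f x * star (_root_.deriv (_root_.deriv f) x) =
      -∫ x : ℝ, _root_.deriv f x * star (_root_.deriv f x) :=
    integral_mul_deriv_eq_deriv_mul_of_integrable
      (u := fun x : ℝ => f x) (u' := fun x : ℝ => _root_.deriv f x)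
      (v := fun x : ℝ => star (_root_.deriv f x))
      (v' := fun x : ℝ => star (_root_.deriv (_root_.deriv f) x))
      (fun x _ => (hf.1 _).hasDerivAt.comp_ofReal)
      (fun x _ => (hd.1 _).hasDerivAt.comp_ofReal.star)
      hi (m1.integrable_mul m1.star) (m0.integrable_mul m1.star)
  have hre : ∫ x : ℝ, (f x * star (_root_.deriv (_root_.deriv f) x)).re =
      -∫ x : ℝ, ‖_root_.deriv f x‖ ^ 2 := by
    have h1 : ∫ x : ℝ, _root_.deriv f x * star (_root_.deriv f x) =
        ((∫ x : ℝ, ‖_root_.deriv f x‖ ^ 2 : ℝ) : ℂ) := by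
      rw [← integral_complex_ofReal]
      refine integral_congr_ae (Eventually.of_forall fun x => ?_)
      simp only [RCLike.star_def, Complex.mul_conj, Complex.normSq_eq_norm_sq]
    have h2 := integral_re hi
    simp only [RCLike.re_to_complex] at h2
    rw [h2, hparts, h1, Complex.neg_re, Complex.ofReal_re]
  have hpt : ∀ x : ℝ, ‖s * f x + _root_.deriv (_root_.deriv f) x‖ ^ 2 =
      s ^ 2 * ‖f x‖ ^ 2 + 2 * s * (f x * star (_root_.deriv (_root_.deriv f) x)).re +
        ‖_root_.deriv (_root_.deriv f) x‖ ^ 2 := by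
    intro x
    simp only [Complex.sq_norm, Complex.normSq_apply, Complex.add_re, Complex.add_im,
      Complex.mul_re, Complex.mul_im, Complex.ofReal_re, Complex.ofReal_im, RCLike.star_def,
      Complex.conj_re, Complex.conj_im]
    ring
  simp only [hpt]
  have hir : Integrable (fun x : ℝ =>
      2 * s * (f x * star (_root_.deriv (_root_.deriv f) x)).re) := hi.re.const_mul _
  have hfs : Integrable (fun x : ℝ => s ^ 2 * ‖f x‖ ^ 2) := hf2.const_mul _
  have hsum : Integrable (fun x : ℝ => s ^ 2 * ‖f x‖ ^ 2 +
      2 * s * (f x * star (_root_.deriv (_root_.deriv f) x)).re) := hfs.add hir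
  rw [integral_add hsum hdd2, integral_add hfs hir, integral_const_mul, integral_const_mul, hre]
  ring

/-- Log-convexity of the square norms of the derivatives. -/
theorem sq_integral_norm_sq_deriv_le (hσ : 0 ≤ σ) (hf : IsEntireOfExpTypeAtMost σ f)
    (hf2 : Integrable (fun x : ℝ => ‖f x‖ ^ 2)) :
    (∫ x : ℝ, ‖_root_.deriv f x‖ ^ 2) ^ 2 ≤
      (∫ x : ℝ, ‖f x‖ ^ 2) * ∫ x : ℝ, ‖_root_.deriv (_root_.deriv f) x‖ ^ 2 := by
  -- The square norm of `s f + f''` is a nonnegative quadratic in `s`, so its discriminant is at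
  -- most zero.
  have h : ∀ s : ℝ, 0 ≤ (∫ x : ℝ, ‖f x‖ ^ 2) * (s * s) +
      (-2 * ∫ x : ℝ, ‖_root_.deriv f x‖ ^ 2) * s +
      ∫ x : ℝ, ‖_root_.deriv (_root_.deriv f) x‖ ^ 2 := by
    intro s
    have h1 := hf.integral_norm_sq_add_deriv_deriv hσ hf2 s
    have h2 : 0 ≤ ∫ x : ℝ, ‖s * f x + _root_.deriv (_root_.deriv f) x‖ ^ 2 :=
      integral_nonneg fun x => by positivity
    linarith
  have := discrim_le_zero h
  rw [discrim] at this
  linarith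

end IsEntireOfExpTypeAtMost

/-! ### Bernstein's inequality from log-convexity and factorial bounds. -/

/-- If `(x r) ^ k / k! ≤ e ^ (σ r)` for all `k` and `r`, then `x ≤ σ`. -/
theorem le_of_forall_pow_le_factorial_mul_exp {σ x : ℝ} (hσ : 0 ≤ σ)
    (h : ∀ (k : ℕ) (r : ℝ), 0 < r → x ^ k ≤ k.factorial * Real.exp (σ * r) / r ^ k) : x ≤ σ := by
  by_contra! hx
  have hx0 : 0 < x := hσ.trans_lt hx
  obtain ⟨m, hm, hmx⟩ := exists_between hx
  have hm0 : 0 < m := hσ.trans_lt hm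
  have hq0 : 0 ≤ m / x := by positivity
  have hq1 : m / x < 1 := (div_lt_one hx0).2 hmx
  -- Weighting the hypothesis by `(m/x)^k` and summing over `k` turns the left side into the series
  -- of `e^(mr)` and the right side into a geometric series times `e^(σr)`.
  have hexp : ∀ r : ℝ, 0 < r → Real.exp ((m - σ) * r) ≤ (1 - m / x)⁻¹ := by
    intro r hr
    have hs : HasSum (fun k : ℕ => (m * r) ^ k / k.factorial) (Real.exp (m * r)) := by
      rw [Real.exp_eq_exp_ℝ]
      exact NormedSpace.expSeries_div_hasSum_exp (m * r)
    have hle := hasSum_le (fun k => ?_) hs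
      ((hasSum_geometric_of_lt_one hq0 hq1).mul_right (Real.exp (σ * r)))
    · rw [sub_mul, Real.exp_sub, div_le_iff₀ (Real.exp_pos _)]
      exact hle
    · have h1 := h k r hr
      rw [le_div_iff₀ (by positivity)] at h1
      rw [div_le_iff₀ (by positivity)]
      calc (m * r) ^ k = (m / x) ^ k * (x ^ k * r ^ k) := by
            rw [← mul_assoc, ← mul_pow, ← mul_pow, div_mul_cancel₀ _ hx0.ne']
        _ ≤ (m / x) ^ k * (k.factorial * Real.exp (σ * r)) := by gcongr
        _ = _ := by ring
  have hms : 0 < m - σ := sub_pos.2 hm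
  have hc : 0 < (1 - m / x)⁻¹ := inv_pos.2 (sub_pos.2 hq1)
  -- With `c = (1 - m/x)⁻¹`, this `r` makes the bound `e^c ≤ c`, contradicting `c + 1 ≤ e^c`.
  have h1 := hexp ((1 - m / x)⁻¹ / (m - σ)) (by positivity)
  rw [mul_div_cancel₀ _ hms.ne'] at h1
  linarith [Real.add_one_le_exp (1 - m / x)⁻¹]

/-- A log-convex sequence dominates the geometric sequence with the ratio of its first terms. -/
theorem pow_le_of_log_convex {a : ℕ → ℝ} (ha : ∀ k, 0 ≤ a k) (ha0 : 0 < a 0)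
    (h : ∀ k, a (k + 1) ^ 2 ≤ a k * a (k + 2)) (k : ℕ) : (a 1 / a 0) ^ k * a 0 ≤ a k := by
  rcases (ha 1).eq_or_lt with h1 | h1
  · rw [← h1, zero_div]
    cases k with
    | zero => simp
    | succ k => simpa using ha (k + 1)
  · have hρ : 0 < a 1 / a 0 := div_pos h1 ha0
    -- Successive ratios never fall below the first one; positivity is carried along so that `a k`
    -- can be cancelled.
    have key : ∀ k, 0 < a k ∧ a 1 / a 0 * a k ≤ a (k + 1) := by
      intro k
      induction k with
      | zero => exact ⟨ha0, (div_mul_cancel₀ _ ha0.ne').le⟩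
      | succ k ih =>
        have hpos : 0 < a (k + 1) := (mul_pos hρ ih.1).trans_le ih.2
        refine ⟨hpos, le_of_mul_le_mul_left ?_ ih.1⟩
        nlinarith [h k, mul_le_mul_of_nonneg_right ih.2 hpos.le]
    induction k with
    | zero => simp
    | succ k ih =>
      refine le_trans ?_ (key k).2
      rw [pow_succ', mul_assoc]
      exact mul_le_mul_of_nonneg_left ih hρ.le

namespace IsEntireOfExpTypeAtMost

variable {σ : ℝ} {f : ℂ → ℂ}

/-- **Bernstein's inequality** in `L²`. -/
theorem integral_norm_sq_deriv_le (hσ : 0 ≤ σ) (hf : IsEntireOfExpTypeAtMost σ f)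
    (hf2 : Integrable (fun x : ℝ => ‖f x‖ ^ 2)) :
    ∫ x : ℝ, ‖_root_.deriv f x‖ ^ 2 ≤ σ ^ 2 * ∫ x : ℝ, ‖f x‖ ^ 2 := by
  let a : ℕ → ℝ := fun k => ∫ x : ℝ, ‖_root_.iteratedDeriv k f x‖ ^ 2
  have ha : ∀ k, 0 ≤ a k := fun k => integral_nonneg fun x => by positivity
  have hlc : ∀ k, a (k + 1) ^ 2 ≤ a k * a (k + 2) := by
    intro k
    have := (hf.iteratedDeriv hσ k).sq_integral_norm_sq_deriv_le hσ
      (hf.integrable_norm_sq_iteratedDeriv hσ hf2 k)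
    simpa only [← iteratedDeriv_succ] using this
  have e0 : a 0 = ∫ x : ℝ, ‖f x‖ ^ 2 := by simp [a]
  have e1 : a 1 = ∫ x : ℝ, ‖_root_.deriv f x‖ ^ 2 := by simp [a]
  rw [← e0, ← e1]
  rcases (ha 0).eq_or_lt with h0 | h0
  -- If `a 0 = 0` there is no ratio to form, but log-convexity already gives `a 1 = 0`.
  · have := hlc 0
    rw [← h0, zero_mul] at this
    rw [← h0, mul_zero]
    exact (pow_eq_zero_iff two_ne_zero).1 (le_antisymm this (sq_nonneg _)) |>.le
  · have hx : √(a 1 / a 0) ≤ σ := by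
      refine le_of_forall_pow_le_factorial_mul_exp hσ fun k r hr => ?_
      refine (sq_le_sq₀ (by positivity) (by positivity)).1 ?_
      rw [← pow_mul, mul_comm k, pow_mul, Real.sq_sqrt (div_nonneg (ha 1) h0.le)]
      refine le_of_mul_le_mul_right ((pow_le_of_log_convex ha h0 hlc k).trans ?_) h0
      rw [e0]
      exact hf.integral_norm_sq_iteratedDeriv_le hσ hf2 k hr
    rw [← div_le_iff₀ h0]
    exact (Real.sqrt_le_left hσ).1 hx

end IsEntireOfExpTypeAtMost

/-! ### Alternating binomial sums and the induction on `N`. -/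

/-- Pascal's rule for alternating binomial sums. -/
theorem sum_neg_pow_mul_choose_succ {R : Type*} [CommRing R] (q : R) (a : ℕ → R) (N : ℕ) :
    ∑ k ∈ Finset.range (N + 2), (-q) ^ k * ((N + 1).choose k : R) * a k =
      ∑ k ∈ Finset.range (N + 1), (-q) ^ k * (N.choose k : R) * (a k - q * a (k + 1)) := by
  have h1 : ∑ k ∈ Finset.range (N + 1), (-q) ^ k * (N.choose k : R) * a k =
      ∑ k ∈ Finset.range (N + 1), (-q) ^ (k + 1) * (N.choose (k + 1) : R) * a (k + 1) + a 0 := by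
    -- The extra term at `k = N + 1` vanishes because `N.choose (N + 1) = 0`.
    have h := Finset.sum_range_succ (fun k => (-q) ^ k * (N.choose k : R) * a k) (N + 1)
    rw [Finset.sum_range_succ'] at h
    simpa using h.symm
  rw [Finset.sum_range_succ']
  simp only [mul_sub, Finset.sum_sub_distrib]
  rw [h1, add_sub_right_comm, ← Finset.sum_sub_distrib]
  simp only [Nat.choose_zero_right, pow_zero, Nat.cast_one, one_mul]
  congr 1
  refine Finset.sum_congr rfl fun k _ => ?_
  rw [Nat.choose_succ_succ]
  push_cast
  ring

namespace IsEntireOfExpTypeAtMost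

variable {σ : ℝ} {f : ℂ → ℂ}

/-- The step of two is what makes the induction close: two factors `1 - ξ²/σ²` form a square,
realised by the function `g = σ² f + f''` of the same class, whereas a single factor has no such
realisation. Hence `f` is generalised and the base cases are `0` and Bernstein's inequality. -/
theorem sum_choose_mul_integral_nonneg (hσ : 0 < σ) (N : ℕ) (hf : IsEntireOfExpTypeAtMost σ f)
    (hf2 : Integrable (fun x : ℝ => ‖f x‖ ^ 2)) :
    0 ≤ ∑ k ∈ Finset.range (N + 1), (-(σ ^ 2)⁻¹) ^ k * (N.choose k : ℝ) *
      ∫ x : ℝ, ‖_root_.iteratedDeriv k f x‖ ^ 2 := by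
  induction N using Nat.twoStepInduction generalizing f with
  | zero => simpa using integral_nonneg fun x => by positivity
  | one =>
    have h := hf.integral_norm_sq_deriv_le hσ.le hf2
    rw [← inv_mul_le_iff₀ (by positivity)] at h
    simp only [Finset.sum_range_succ, Finset.sum_range_zero, iteratedDeriv_zero, iteratedDeriv_one]
    simpa using h
  | more N ih _ =>
    have hd := hf.deriv hσ.le
    have hdd := hd.deriv hσ.le
    have hs : (0 : ℝ) < σ ^ 2 := by positivity
    let g : ℂ → ℂ := fun z => ((σ ^ 2 : ℝ) : ℂ) * f z + _root_.deriv (_root_.deriv f) z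
    have hg : IsEntireOfExpTypeAtMost σ g := (hf.const_mul _).add hdd
    have hg2 : Integrable (fun x : ℝ => ‖g x‖ ^ 2) := by
      rw [integrable_norm_sq_iff_memLp hg.1.continuous]
      refine MemLp.add (MemLp.const_mul ?_ _) ?_
      · exact (integrable_norm_sq_iff_memLp hf.1.continuous).1 hf2
      · exact (integrable_norm_sq_iff_memLp hdd.1.continuous).1
          (hd.integrable_norm_sq_deriv hσ.le (hf.integrable_norm_sq_deriv hσ.le hf2))
    have hgk : ∀ k, _root_.iteratedDeriv k g = fun z => ((σ ^ 2 : ℝ) : ℂ) *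
        _root_.iteratedDeriv k f z +
          _root_.deriv (_root_.deriv (_root_.iteratedDeriv k f)) z := by
      intro k
      induction k with
      | zero => simp [g]
      | succ k ihk =>
        have hk := hf.iteratedDeriv hσ.le k
        rw [iteratedDeriv_succ, ihk, iteratedDeriv_succ]
        funext z
        exact (((hk.1 z).hasDerivAt.const_mul _).add
          (((hk.deriv hσ.le).deriv hσ.le).1 z).hasDerivAt).deriv
    have key := ih hg hg2
    -- Two uses of Pascal's rule leave the second differences `a k - 2q a (k+1) + q² a (k+2)` with
    -- `q = σ⁻²`. Each equals `q²` times the square norm of the `k`-th derivative of `g`.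
    rw [sum_neg_pow_mul_choose_succ, sum_neg_pow_mul_choose_succ]
    have := mul_nonneg (sq_nonneg (σ ^ 2)⁻¹) key
    rw [Finset.mul_sum] at this
    refine this.trans (le_of_eq (Finset.sum_congr rfl fun k _ => ?_))
    have hi := (hf.iteratedDeriv hσ.le k).integral_norm_sq_add_deriv_deriv hσ.le
      (hf.integrable_norm_sq_iteratedDeriv hσ.le hf2 k) (σ ^ 2)
    simp only [hgk, iteratedDeriv_succ]
    rw [hi]
    field_simp
    ring

end IsEntireOfExpTypeAtMost

theorem mainTheorem7 (σ : ℝ) (hσ : 0 < σ) (f : ℂ → ℂ)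
    (hf : IsEntireOfExpTypeAtMost σ f)
    (hf2 : MeasureTheory.MemLp (fun x : ℝ => f (x : ℂ)) 2 MeasureTheory.volume) :
    (∀ k : ℕ, MeasureTheory.Integrable (fun x : ℝ => ‖iteratedDeriv k f (x : ℂ)‖ ^ 2)
      MeasureTheory.volume) ∧
    (∀ N : ℕ, 0 ≤ ∑ k ∈ Finset.range (N + 1),
      (-1 : ℝ) ^ k / σ ^ (2 * k) * (N.choose k : ℝ) *
        ∫ x : ℝ, ‖iteratedDeriv k f (x : ℂ)‖ ^ 2) ∧
    ∫ x : ℝ, ‖deriv f (x : ℂ)‖ ^ 2 ≤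
      1 / 2 * (σ ^ 2 * (∫ x : ℝ, ‖f (x : ℂ)‖ ^ 2) +
        1 / σ ^ 2 * ∫ x : ℝ, ‖deriv (deriv f) (x : ℂ)‖ ^ 2) := by
  have hi := (integrable_norm_sq_iff_memLp hf.1.continuous).2 hf2
  refine ⟨hf.integrable_norm_sq_iteratedDeriv hσ.le hi, fun N => ?_, ?_⟩
  · have h := hf.sum_choose_mul_integral_nonneg hσ N hi
    refine h.trans (le_of_eq (Finset.sum_congr rfl fun k _ => ?_))
    rw [pow_mul, div_eq_mul_inv, ← inv_pow (σ ^ 2), ← mul_pow, neg_one_mul]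
  · have h := hf.sum_choose_mul_integral_nonneg hσ 2 hi
    simp only [Finset.sum_range_succ, Finset.sum_range_zero, iteratedDeriv_succ,
      iteratedDeriv_zero] at h
    norm_num at h
    have hs : (0 : ℝ) < σ ^ 2 := by positivity
    -- The case `N = 2` times `σ² / 2` is exactly the difference of the two sides.
    have h' := mul_nonneg hs.le h
    refine le_of_sub_nonneg ?_
    refine (div_nonneg h' zero_le_two).trans (le_of_eq ?_)
    field_simp
    ring
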